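/- All rings are associative with identity and modules are left modules unless a side is indicated. Let $R$ and $S$ be rings and let ${}_RC_S$ be a semidualizing $(R,S)$-bimodule, that is: ${}_RC$ and $C_S$ both admit projective resolutions by finitely generated projective modules; the homothety maps $R\to\operatorname{Hom}_{S^{op}}(C,C)$ and $S\to\operatorname{Hom}_R(C,C)$ are isomorphisms; and $\operatorname{Ext}_R^{i}(C,C)=0=\operatorname{Ext}_{S^{op}}^{i}(C,C)$ for all $i\ge 1$. The Auslander class $\mathcal A_C(S)$ consists of all $S$-modules $N$ such that $\operatorname{Tor}^S_i(C,N)=0$ for all $i\ge 1$, $\operatorname{Ext}_R^i(C,C\otimes_SN)=0$ for all $i\ge 1$, and the map $\mu_N:N\to\operatorname{Hom}_R(C,C\otimes_SN)$, $\mu_N(x)(c)=c\otimes x$, is an isomorphism. The Auslander projective dimension of an $S$-module $N$ is the infimum of all $n\ge 0$ for which there is an exact sequence $0\to X_n\to\cdots\to X_1\to X_0\to N\to 0$ of $S$-modules with all $X_i\in\mathcal A_C(S)$; it is infinite if there is no such $n$. Then the class of $S$-modules of finite Auslander projective dimension is closed under extensions, kernels of epimorphisms and cokernels of monomorphisms.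 That is, for every exact sequence $0\to N_1\to N_2\to N_3\to 0$ of $S$-modules: (1) if $N_1$ and $N_3$ have finite Auslander projective dimension, then so has $N_2$; (2) if $N_2$ and $N_3$ have finite Auslander projective dimension, then so has $N_1$; (3) if $N_1$ and $N_2$ have finite Auslander projective dimension, then so has $N_3$. -/

import Mathlib

open CategoryTheory
open scoped TensorProduct

universe u

noncomputable section

namespace AuslanderPd

/-! A left `R`-, right `S`-bimodule `C` is encoded by `[Module R C] [Module Sᵐᵒᵖ C]` together with
`[SMulCommClass R Sᵐᵒᵖ C]`; the right action `c · s` is `MulOpposite.op s • c`. -/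

section Tensor

variable (R S C : Type u) [Ring R] [Ring S] [AddCommGroup C] [Module R C] [Module Sᵐᵒᵖ C]
  (N N' N'' : Type u) [AddCommGroup N] [Module S N] [AddCommGroup N'] [Module S N']
  [AddCommGroup N''] [Module S N'']

/-- The relations `c s ⊗ x = c ⊗ s x` that turn `C ⊗_ℤ N` into `C ⊗_S N`. (For an `(R,S)`-bimodule
the generating set is stable under `R`, so its `R`-span is the subgroup that it generates; see
`balancedRel_eq_closure`.) -/
def balancedRel : Submodule R (C ⊗[ℤ] N) :=
  Submodule.span R {t | ∃ (c : C) (s : S) (x : N),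
    t = (MulOpposite.op s • c) ⊗ₜ[ℤ] x - c ⊗ₜ[ℤ] (s • x)}

/-- The tensor product `C ⊗_S N` over the (not necessarily commutative) ring `S`, as a left
`R`-module. -/
abbrev BTensor : Type u := (C ⊗[ℤ] N) ⧸ balancedRel R S C N

variable {C N N' N''}

/-- The class `c ⊗ x` in `C ⊗_S N`. -/
def btmul (c : C) (x : N) : BTensor R S C N := Submodule.Quotient.mk (c ⊗ₜ[ℤ] x)

theorem btmul_add (c : C) (x y : N) :
    btmul R S c (x + y) = btmul R S c x + btmul R S c y := by
  simp [btmul, TensorProduct.tmul_add]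

theorem add_btmul (c d : C) (x : N) :
    btmul R S (c + d) x = btmul R S c x + btmul R S d x := by
  simp [btmul, TensorProduct.add_tmul]

theorem smul_btmul (r : R) (c : C) (x : N) :
    btmul R S (r • c) x = r • btmul R S c x := rfl

theorem btmul_balanced (c : C) (s : S) (x : N) :
    btmul R S (MulOpposite.op s • c) x = btmul R S c (s • x) :=
  (Submodule.Quotient.eq _).2 (Submodule.subset_span ⟨c, s, x, rfl⟩)

variable (C) in
theorem balancedRel_eq_closure [SMulCommClass R Sᵐᵒᵖ C] :
    (balancedRel R S C N).toAddSubgroup = AddSubgroup.closure {t | ∃ (c : C) (s : S) (x : N),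
      t = (MulOpposite.op s • c) ⊗ₜ[ℤ] x - c ⊗ₜ[ℤ] (s • x)} := by
  apply le_antisymm
  · intro t ht
    refine Submodule.span_induction (p := fun t _ => t ∈ AddSubgroup.closure _)
      (fun t ht => AddSubgroup.subset_closure ht) (zero_mem _)
      (fun _ _ _ _ h h' => add_mem h h') (fun r t ht' h => ?_) ht
    clear ht'
    induction h using AddSubgroup.closure_induction with
    | mem t ht =>
      obtain ⟨c, s, x, rfl⟩ := ht
      refine AddSubgroup.subset_closure ⟨r • c, s, x, ?_⟩
      rw [smul_sub, TensorProduct.smul_tmul', TensorProduct.smul_tmul', smul_comm]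
    | zero => simp
    | add _ _ _ _ h h' => rw [smul_add]; exact add_mem h h'
    | neg _ _ h => rw [smul_neg]; exact neg_mem h
  · rw [AddSubgroup.closure_le]
    exact Submodule.subset_span

/-- The map `C ⊗_S f : C ⊗_S N → C ⊗_S N'`, `c ⊗ x ↦ c ⊗ f x`. -/
def btensorMap (f : N →ₗ[S] N') : BTensor R S C N →ₗ[R] BTensor R S C N' :=
  Submodule.mapQ _ _
    (TensorProduct.AlgebraTensorModule.lTensor R C (f.toAddMonoidHom.toIntLinearMap)) (by
      rw [balancedRel, Submodule.span_le]
      rintro _ ⟨c, s, x, rfl⟩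
      refine Submodule.subset_span ⟨c, s, f x, ?_⟩
      simp)

@[simp]
theorem btensorMap_btmul (f : N →ₗ[S] N') (c : C) (x : N) :
    btensorMap R S f (btmul R S c x) = btmul R S c (f x) := rfl

theorem btensor_hom_ext {M : Type u} [AddCommGroup M] [Module R M]
    {f g : BTensor R S C N →ₗ[R] M}
    (h : ∀ c x, f (btmul R S c x) = g (btmul R S c x)) : f = g := by
  apply Submodule.linearMap_qext
  apply TensorProduct.AlgebraTensorModule.curry_injective
  ext c x
  exact h c x

variable (C) in
/-- The functor `C ⊗_S - : Mod S ⥤ Mod R`. -/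
def tensorFunctor : ModuleCat.{u} S ⥤ ModuleCat.{u} R where
  obj N := ModuleCat.of R (BTensor R S C N)
  map f := ModuleCat.ofHom (btensorMap R S f.hom)
  map_id N := by
    ext1
    exact btensor_hom_ext R S fun c x => rfl
  map_comp f g := by
    ext1
    exact btensor_hom_ext R S fun c x => rfl

instance tensorFunctor_additive : (tensorFunctor R S C).Additive where
  map_add {N N' f g} := by
    ext1
    exact btensor_hom_ext R S fun c x => btmul_add R S c (f.hom x) (g.hom x)

variable (C) in
/-- `Tor_i^S(C, -)`, the `i`-th left derived functor of `C ⊗_S -`. -/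
def torFunctor (i : ℕ) : ModuleCat.{u} S ⥤ ModuleCat.{u} R :=
  (tensorFunctor R S C).leftDerived i

/-- The canonical valuation homomorphism `μ_N : N → Hom_R(C, C ⊗_S N)`, `μ_N(x)(c) = c ⊗ x`. -/
def mu (x : N) : C →ₗ[R] BTensor R S C N where
  toFun c := btmul R S c x
  map_add' c d := add_btmul R S c d x
  map_smul' r c := smul_btmul R S r c x

theorem mu_add (x y : N) : mu R S (C := C) (x + y) = mu R S x + mu R S y :=
  LinearMap.ext fun c => btmul_add R S c x y

/-- `μ_N` is `S`-linear for the action `(s f)(c) = f(c s)` on `Hom_R(C, C ⊗_S N)`; hence it is an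
isomorphism of `S`-modules if and only if it is bijective. -/
theorem mu_smul (s : S) (x : N) (c : C) :
    mu R S (s • x) c = mu R S x (MulOpposite.op s • c) :=
  (btmul_balanced R S c s x).symm

end Tensor

section Semidualizing

/-- `M` admits a projective resolution by finitely generated projective modules. -/
def HasDegreewiseFiniteResolution (A : Type u) [Ring A] (M : Type u) [AddCommGroup M]
    [Module A M] : Prop :=
  ∃ P : ProjectiveResolution (ModuleCat.of A M), ∀ i, Module.Finite A (P.complex.X i)

variable (R S C : Type u) [Ring R] [Ring S] [AddCommGroup C] [Module R C] [Module Sᵐᵒᵖ C]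
  [SMulCommClass R Sᵐᵒᵖ C]

/-- The homothety `c ↦ r c`, an endomorphism of the right `S`-module `C`. -/
def homothetyLeft (r : R) : C →ₗ[Sᵐᵒᵖ] C where
  toFun c := r • c
  map_add' := smul_add r
  map_smul' s c := smul_comm r s c

/-- The homothety `c ↦ c s`, an endomorphism of the left `R`-module `C`. -/
def homothetyRight (s : S) : C →ₗ[R] C where
  toFun c := MulOpposite.op s • c
  map_add' := smul_add _
  map_smul' r c := (smul_comm r (MulOpposite.op s) c).symm

/-- The `(R,S)`-bimodule `C` is semidualizing. -/
structure IsSemidualizing : Prop where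
  finite_left : HasDegreewiseFiniteResolution R C
  finite_right : HasDegreewiseFiniteResolution Sᵐᵒᵖ C
  homothety_left : Function.Bijective (homothetyLeft R S C)
  homothety_right : Function.Bijective (homothetyRight R S C)
  ext_left : ∀ i : ℕ, 1 ≤ i →
    Subsingleton (Abelian.Ext.{u} (ModuleCat.of R C) (ModuleCat.of R C) i)
  ext_right : ∀ i : ℕ, 1 ≤ i →
    Subsingleton (Abelian.Ext.{u} (ModuleCat.of Sᵐᵒᵖ C) (ModuleCat.of Sᵐᵒᵖ C) i)

end Semidualizing

section Auslander

/-- The Auslander class `A_C(S)`, as a full subcategory of `Mod S`. -/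
structure auslanderClass (R S C : Type u) [Ring R] [Ring S] [AddCommGroup C] [Module R C]
    [Module Sᵐᵒᵖ C] (N : ModuleCat.{u} S) : Prop where
  tor_zero : ∀ i : ℕ, 1 ≤ i → Limits.IsZero ((torFunctor R S C i).obj N)
  ext_zero : ∀ i : ℕ, 1 ≤ i →
    Subsingleton (Abelian.Ext.{u} (ModuleCat.of R C) ((tensorFunctor R S C).obj N) i)
  mu_bijective : Function.Bijective (mu R S : N → (C →ₗ[R] BTensor R S C N))

variable {S : Type u} [Ring S]

/-- There is an exact sequence `0 → X n → ⋯ → X 1 → X 0 → N → 0` in `Mod S` with all `X i` in `P`.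
(It is continued to the left by zero modules, so that exactness at `X n` says that `X n → X (n-1)`,
or `X 0 → N` if `n = 0`, is injective.) -/
def HasResolutionOfLength (P : ObjectProperty (ModuleCat.{u} S)) (N : ModuleCat.{u} S)
    (n : ℕ) : Prop :=
  ∃ (X : ℕ → ModuleCat.{u} S) (d : ∀ i, X (i + 1) →ₗ[S] X i) (ε : X 0 →ₗ[S] N),
    (∀ i, i ≤ n → P (X i)) ∧ (∀ i, n < i → Subsingleton (X i)) ∧
    Function.Surjective ε ∧ Function.Exact (d 0) ε ∧
    ∀ i, Function.Exact (d (i + 1)) (d i)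

/-- The `P`-projective dimension of `N`: the infimum of the lengths of the finite resolutions of `N`
by modules in `P`, and `⊤` if there is none. -/
def relProjDim (P : ObjectProperty (ModuleCat.{u} S)) (N : ModuleCat.{u} S) : ℕ∞ :=
  sInf ((fun n : ℕ => (n : ℕ∞)) '' {n | HasResolutionOfLength P N n})

/-- The class of the `S`-modules of finite Auslander projective dimension with respect to `C`. -/
def finiteAuslanderPd (R S C : Type u) [Ring R] [Ring S] [AddCommGroup C] [Module R C]
    [Module Sᵐᵒᵖ C] : ObjectProperty (ModuleCat.{u} S) :=
  fun N => relProjDim (auslanderClass R S C) N < ⊤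

end Auslander

end AuslanderPd

end

/-!
By the adjunction between `C ⊗_S -` and `Hom_R(C, -)`, the vanishing of `Tor_i^S(C, N)` amounts to
that of `Ext_S^i(N, Hom_R(C, I))` for all injective `I`, and `μ` is the unit of the adjunction.
Hence `A_C(S)` is closed under extensions and kernels of epimorphisms, by the long exact `Ext`
sequences and the five lemma for `μ`. It contains the free modules: as `C` has a resolution by
finitely generated projectives, `Hom_R(C, -)` and `Ext_R^i(C, -)` take `C ⊗_S S^(J) ≃ C^(J)` to the
direct sums of copies of `Hom_R(C, C) ≃ S` and of `Ext_R^i(C, C) = 0`. So `A_C(S)` is resolving, and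
for a resolving class two-out-of-three for finite resolutions follows by induction on the length,
with the horseshoe lemma and pullbacks along the first step of a resolution.
-/

noncomputable section

namespace AuslanderPd

section Abelian

open Limits ZeroObject

universe v w

variable {𝒜 : Type w} [Category.{v} 𝒜] [Abelian 𝒜]

theorem shortExact_of_isPullback {S : ShortComplex 𝒜} (hS : S.ShortExact) {A E : 𝒜}
    {p : E ⟶ S.X₂} {q : E ⟶ A} {φ : A ⟶ S.X₃} (sq : IsPullback p q S.g φ) :
    (ShortComplex.mk (sq.lift S.f 0 (by simp)) q (sq.lift_snd _ _ _)).ShortExact := by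
  have := hS.mono_f
  have := hS.epi_g
  have : Mono (sq.lift S.f 0 (by simp)) := mono_of_mono_fac (sq.lift_fst _ _ _)
  refine .mk' (ShortComplex.exact_of_f_is_kernel _ ?_) this
    (Abelian.epi_snd_of_isLimit _ _ sq.isLimit)
  refine KernelFork.IsLimit.ofι' _ _ fun {T} t ht => ?_
  have ht' : (t ≫ p) ≫ S.g = 0 := by rw [Category.assoc, sq.w, reassoc_of% ht, zero_comp]
  exact ⟨hS.exact.lift (t ≫ p) ht', sq.hom_ext (by simp) (by simp [ht])⟩

theorem shortExact_comp {S : ShortComplex 𝒜} (hS : S.ShortExact) {Y M : 𝒜}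
    {p : Y ⟶ S.X₂} [Epi p] {i : M ⟶ Y} {q : M ⟶ S.X₁} (sq : IsPullback i q p S.f) :
    (ShortComplex.mk i (p ≫ S.g)
      (by rw [reassoc_of% sq.w, S.zero, comp_zero])).ShortExact := by
  have := hS.mono_f
  have := hS.epi_g
  have : Mono i := ⟨fun a b h => sq.hom_ext h <| by
    rw [← cancel_mono S.f, Category.assoc, Category.assoc, ← sq.w, reassoc_of% h]⟩
  refine .mk' (ShortComplex.exact_of_f_is_kernel _ ?_) ‹_› (epi_comp p S.g)
  refine KernelFork.IsLimit.ofι' _ _ fun {T} t ht => ?_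
  have ht' : (t ≫ p) ≫ S.g = 0 := by rw [Category.assoc, ht]
  exact ⟨sq.lift t (hS.exact.lift (t ≫ p) ht') (by simp), by simp⟩

theorem shortExact_of_splitting {S : ShortComplex 𝒜} (s : S.Splitting) :
    (ShortComplex.mk s.s s.r s.s_r).ShortExact :=
  { r := S.g
    s := S.f
    id := by rw [add_comm]; exact s.id : ShortComplex.Splitting _ }.shortExact

theorem shortExact_id {Z : 𝒜} (hZ : IsZero Z) (X : 𝒜) :
    (ShortComplex.mk (0 : Z ⟶ X) (𝟙 X) zero_comp).ShortExact :=
  { exact := (ShortComplex.exact_iff_mono _ rfl).2 inferInstance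
    mono_f := hZ.mono 0 }

/-- `P` is resolving: it is closed under extensions and kernels of epimorphisms, and every object is
a quotient of a projective object of `P`. -/
structure IsResolving (P : ObjectProperty 𝒜) : Prop where
  prop_X₂ {S : ShortComplex 𝒜} : S.ShortExact → P S.X₁ → P S.X₃ → P S.X₂
  prop_X₁ {S : ShortComplex 𝒜} : S.ShortExact → P S.X₂ → P S.X₃ → P S.X₁
  exists_epi (N : 𝒜) : ∃ (Q : 𝒜) (π : Q ⟶ N), Projective Q ∧ P Q ∧ Epi π

/-- The class of the objects with a finite resolution `0 → Xₙ → ⋯ → X₀ → N → 0` by objects of `P`,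
as the smallest class that contains the zero objects and contains `N` as soon as it contains the
kernel of an epimorphism from an object of `P` onto `N`. -/
inductive HasFiniteResolution (P : ObjectProperty 𝒜) : ObjectProperty 𝒜
  | zero {N : 𝒜} : IsZero N → HasFiniteResolution P N
  | cons {S : ShortComplex 𝒜} : S.ShortExact → P S.X₂ → HasFiniteResolution P S.X₁ →
      HasFiniteResolution P S.X₃

namespace HasFiniteResolution

variable {P : ObjectProperty 𝒜}

theorem of_iso {N N' : 𝒜} (e : N ≅ N') (hN : HasFiniteResolution P N) :
    HasFiniteResolution P N' := by
  cases hN with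
  | zero h => exact .zero (h.of_iso e.symm)
  | @cons S hS hX hK =>
    let e' : S ≅ .mk S.f (S.g ≫ e.hom) (by rw [reassoc_of% S.zero, zero_comp]) :=
      ShortComplex.isoMk (Iso.refl _) (Iso.refl _) e
    exact .cons (ShortComplex.shortExact_of_iso e' hS) hX hK

theorem of_prop {X : 𝒜} (hX : P X) : HasFiniteResolution P X :=
  .cons (shortExact_id (isZero_zero 𝒜) X) hX (.zero (isZero_zero 𝒜))

end HasFiniteResolution

namespace IsResolving

variable {P : ObjectProperty 𝒜}

theorem prop_of_isZero (hP : IsResolving P) {Z : 𝒜} (hZ : IsZero Z) : P Z := by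
  obtain ⟨Q, _, _, hQ, _⟩ := hP.exists_epi Z
  exact hP.prop_X₁ (shortExact_id hZ Q) hQ hQ

theorem exists_horseshoe (hP : IsResolving P) {T U : ShortComplex 𝒜} (hT : T.ShortExact)
    (hU : U.ShortExact) [Projective U.X₂] (hTP : P T.X₂) (hUP : P U.X₂) {B : 𝒜} {f : T.X₃ ⟶ B}
    {g : B ⟶ U.X₃} {w : f ≫ g = 0} (hS : (ShortComplex.mk f g w).ShortExact) :
    ∃ (W M : 𝒜) (i : M ⟶ W) (p : W ⟶ B) (j : T.X₁ ⟶ M) (q : M ⟶ U.X₁) (w₁ : i ≫ p = 0)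
      (w₂ : j ≫ q = 0), P W ∧ (ShortComplex.mk i p w₁).ShortExact ∧
      (ShortComplex.mk j q w₂).ShortExact := by
  have := hT.epi_g
  have sqE := IsPullback.of_hasPullback g U.g
  have s := (shortExact_of_isPullback hS sqE).splittingOfProjective
  have sqW := IsPullback.of_hasPullback T.g s.r
  have sqM := IsPullback.of_hasPullback (pullback.snd T.g s.r) (sqE.flip.lift U.f 0 (by simp))
  have hW := shortExact_of_isPullback (shortExact_of_splitting s) sqW.flip
  exact ⟨_, _, _, _, _, _, _, _, hP.prop_X₂ hW hUP hTP,
    shortExact_comp (shortExact_of_isPullback hU sqE.flip) sqM,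
    shortExact_of_isPullback (shortExact_of_isPullback hT sqW) sqM⟩

/-- With `𝒬 = P` this gives the closure under kernels that makes it apply to
`𝒬 = HasFiniteResolution P`. -/
theorem hasFiniteResolution_X₂_of_le (hP : IsResolving P) {𝒬 : ObjectProperty 𝒜}
    (h𝒬 : 𝒬 ≤ HasFiniteResolution P)
    (hker : ∀ ⦃S : ShortComplex 𝒜⦄, S.ShortExact → P S.X₂ → 𝒬 S.X₃ → 𝒬 S.X₁)
    {S : ShortComplex 𝒜} (hS : S.ShortExact) (h₁ : HasFiniteResolution P S.X₁) (h₃ : 𝒬 S.X₃) :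
    HasFiniteResolution P S.X₂ := by
  obtain @⟨A, B, C, f, g, w⟩ := S
  dsimp only at h₁ h₃ ⊢
  induction h₁ generalizing B C with
  | zero h =>
    have := hS.isIso_g_iff.2 h
    exact (h𝒬 _ h₃).of_iso (asIso g).symm
  | cons hT hTP _ ih =>
    obtain ⟨Q, π, _, hQ, _⟩ := hP.exists_epi C
    have hU : (ShortComplex.mk (kernel.ι π) π (kernel.condition π)).ShortExact :=
      { exact := ShortComplex.exact_kernel π }
    obtain ⟨W, M, i, p, j, q, _, _, hW, hWM, hM⟩ := hP.exists_horseshoe hT hU hTP hQ hS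
    exact .cons hWM hW (ih j q _ hM (hker hU hQ h₃))

theorem hasFiniteResolution_X₁_of_prop_X₃ (hP : IsResolving P) {S : ShortComplex 𝒜}
    (hS : S.ShortExact) (h₂ : HasFiniteResolution P S.X₂) (h₃ : P S.X₃) :
    HasFiniteResolution P S.X₁ := by
  obtain @⟨A, B, C, f, g, w⟩ := S
  dsimp only at h₂ h₃ ⊢
  cases h₂ with
  | zero h =>
    have := hS.mono_f
    exact .zero (IsZero.of_mono f h)
  | @cons T hT hTP hTK =>
    have := hT.epi_g
    have sq := IsPullback.of_hasPullback T.g f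
    exact .cons (shortExact_of_isPullback hT sq) (hP.prop_X₁ (shortExact_comp hS sq) hTP h₃) hTK

theorem hasFiniteResolution_X₁_of_prop_X₂ (hP : IsResolving P) {S : ShortComplex 𝒜}
    (hS : S.ShortExact) (h₂ : P S.X₂) (h₃ : HasFiniteResolution P S.X₃) :
    HasFiniteResolution P S.X₁ := by
  obtain @⟨A, B, C, f, g, w⟩ := S
  dsimp only at h₂ h₃ ⊢
  cases h₃ with
  | zero h =>
    have := hS.isIso_f_iff.2 h
    exact (HasFiniteResolution.of_prop h₂).of_iso (asIso f).symm
  | @cons T hT hTP hTK =>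
    have sq := IsPullback.of_hasPullback T.g g
    have hE := hP.hasFiniteResolution_X₂_of_le (fun _ => .of_prop) (fun _ => hP.prop_X₁)
      (shortExact_of_isPullback hT sq) hTK h₂
    exact hP.hasFiniteResolution_X₁_of_prop_X₃ (shortExact_of_isPullback hS sq.flip) hE hTP

theorem hasFiniteResolution_X₂ (hP : IsResolving P) {S : ShortComplex 𝒜} (hS : S.ShortExact)
    (h₁ : HasFiniteResolution P S.X₁) (h₃ : HasFiniteResolution P S.X₃) :
    HasFiniteResolution P S.X₂ :=
  hP.hasFiniteResolution_X₂_of_le le_rfl (fun _ => hP.hasFiniteResolution_X₁_of_prop_X₂) hS h₁ h₃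

theorem hasFiniteResolution_X₃ (hP : IsResolving P) {S : ShortComplex 𝒜} (hS : S.ShortExact)
    (h₁ : HasFiniteResolution P S.X₁) (h₂ : HasFiniteResolution P S.X₂) :
    HasFiniteResolution P S.X₃ := by
  obtain @⟨A, B, C, f, g, w⟩ := S
  dsimp only at h₁ h₂ ⊢
  cases h₂ with
  | zero h =>
    have := hS.epi_g
    exact .zero (IsZero.of_epi g h)
  | @cons T hT hTP hTK =>
    have := hT.epi_g
    have sq := IsPullback.of_hasPullback T.g f
    exact .cons (shortExact_comp hS sq) hTP
      (hP.hasFiniteResolution_X₂ (shortExact_of_isPullback hT sq) hTK h₁)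

theorem hasFiniteResolution_X₁ (hP : IsResolving P) {S : ShortComplex 𝒜} (hS : S.ShortExact)
    (h₂ : HasFiniteResolution P S.X₂) (h₃ : HasFiniteResolution P S.X₃) :
    HasFiniteResolution P S.X₁ := by
  obtain @⟨A, B, C, f, g, w⟩ := S
  dsimp only at h₂ h₃ ⊢
  cases h₂ with
  | zero h =>
    have := hS.mono_f
    exact .zero (IsZero.of_mono f h)
  | @cons T hT hTP hTK =>
    have := hT.epi_g
    have sq := IsPullback.of_hasPullback T.g f
    exact hP.hasFiniteResolution_X₃ (shortExact_of_isPullback hT sq) hTK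
      (hP.hasFiniteResolution_X₁_of_prop_X₂ (shortExact_comp hS sq) hTP h₃)

end IsResolving

end Abelian

section ModuleCat

open Limits

variable {S : Type u} [Ring S] {P : ObjectProperty (ModuleCat.{u} S)}

theorem HasResolutionOfLength.hasFiniteResolution {n : ℕ} {N : ModuleCat.{u} S}
    (h : HasResolutionOfLength P N n) : HasFiniteResolution P N := by
  obtain ⟨X, d, ε, hX, hX', hε, hdε, hd⟩ := h
  let δ := (d 0).codRestrict (LinearMap.ker ε) hdε.apply_apply_eq_zero
  have hδ : Function.Surjective δ := fun ⟨x, hx⟩ => by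
    obtain ⟨y, rfl⟩ := (hdε x).1 hx
    exact ⟨y, rfl⟩
  refine .cons (LinearMap.shortExact_shortComplexKer hε) (hX 0 (Nat.zero_le _)) ?_
  cases n with
  | zero =>
    have := hX' 1 zero_lt_one
    have : Subsingleton (LinearMap.ker ε) := hδ.subsingleton
    exact .zero (ModuleCat.isZero_of_subsingleton (ModuleCat.of S (LinearMap.ker ε)))
  | succ n =>
    refine hasFiniteResolution (n := n) ⟨fun i => X (i + 1), fun i => d (i + 1), δ,
      fun i hi => hX _ (by lia), fun i hi => hX' _ (by lia), hδ, fun x => ?_, fun i => hd (i + 1)⟩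
    rw [← hd 0 x]
    exact Subtype.ext_iff

theorem HasResolutionOfLength.cons {T : ShortComplex (ModuleCat.{u} S)} (hT : T.ShortExact)
    (h₂ : P T.X₂) {n : ℕ} (h₁ : HasResolutionOfLength P T.X₁ n) :
    HasResolutionOfLength P T.X₃ (n + 1) := by
  obtain ⟨X, d, ε, hX, hX', hε, hdε, hd⟩ := h₁
  have hTf : Function.Injective T.f.hom := hT.moduleCat_injective_f
  have hTg : Function.Exact T.f.hom T.g.hom :=
    (ShortComplex.ShortExact.moduleCat_exact_iff_function_exact T).1 hT.exact
  refine ⟨fun i => Nat.casesOn i T.X₂ X,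
    fun i => match i with
      | 0 => T.f.hom ∘ₗ ε
      | i + 1 => d i,
    T.g.hom, ?_, ?_, hT.moduleCat_surjective_g, fun x => ?_, ?_⟩
  · rintro (_ | i) hi
    exacts [h₂, hX i (by lia)]
  · rintro (_ | i) hi
    exacts [absurd hi (by lia), hX' i (by lia)]
  · rw [hTg x, LinearMap.coe_comp, hε.range_comp]
  · rintro (_ | i)
    exacts [hdε.comp_injective _ hTf (map_zero T.f.hom), hd i]

theorem HasFiniteResolution.exists_hasResolutionOfLength (h0 : ∀ ⦃Z⦄, IsZero Z → P Z)
    {N : ModuleCat.{u} S} (h : HasFiniteResolution P N) : ∃ n, HasResolutionOfLength P N n := by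
  induction h with
  | @zero N hN =>
    have : Subsingleton N := ModuleCat.subsingleton_of_isZero hN
    have hex : Function.Exact (0 : N →ₗ[S] N) (0 : N →ₗ[S] N) := fun x =>
      ⟨fun _ => ⟨0, Subsingleton.elim _ _⟩, fun _ => rfl⟩
    exact ⟨0, fun _ => N, 0, 0, fun _ _ => h0 hN, fun _ _ => this,
      Function.surjective_to_subsingleton _, hex, fun _ => hex⟩
  | cons hT hT₂ _ ih =>
    obtain ⟨n, hn⟩ := ih
    exact ⟨n + 1, .cons hT hT₂ hn⟩

theorem relProjDim_lt_top_iff (h0 : ∀ ⦃Z⦄, IsZero Z → P Z) {N : ModuleCat.{u} S} :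
    relProjDim P N < ⊤ ↔ HasFiniteResolution P N := by
  rw [relProjDim, sInf_lt_iff]
  constructor
  · rintro ⟨_, ⟨n, hn, rfl⟩, -⟩
    exact hn.hasFiniteResolution
  · intro h
    obtain ⟨n, hn⟩ := h.exists_hasResolutionOfLength h0
    exact ⟨n, ⟨n, hn, rfl⟩, ENat.natCast_lt_top n⟩

end ModuleCat

section Ext

open Limits Abelian

universe t v w

variable {𝒜 : Type w} [Category.{v} 𝒜] [Abelian 𝒜] [HasExt.{t} 𝒜]

theorem subsingleton_ext_succ_iff {X Y : 𝒜} (P : ProjectiveResolution X) (n : ℕ) :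
    Subsingleton (Ext X Y (n + 1)) ↔
      ∀ f : P.complex.X (n + 1) ⟶ Y, P.complex.d (n + 2) (n + 1) ≫ f = 0 →
        ∃ g : P.complex.X n ⟶ Y, P.complex.d (n + 1) n ≫ g = f := by
  constructor
  · intro h f hf
    exact (P.extMk_eq_zero_iff f (n + 2) rfl hf n rfl).1 (Subsingleton.elim _ _)
  · refine fun h => subsingleton_of_forall_eq 0 fun α => ?_
    obtain ⟨f, hf, rfl⟩ := P.extMk_surjective α (n + 2) rfl
    exact (P.extMk_eq_zero_iff f (n + 2) rfl hf n rfl).2 (h f hf)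

variable {T : ShortComplex 𝒜} (hT : T.ShortExact)

include hT

theorem exists_comp_eq_of_subsingleton_ext {Y : 𝒜} (h : Subsingleton (Ext T.X₃ Y 1))
    (φ : T.X₁ ⟶ Y) : ∃ ψ : T.X₂ ⟶ Y, T.f ≫ ψ = φ := by
  obtain ⟨x, hx⟩ := Ext.contravariant_sequence_exact₁ hT Y (Ext.mk₀ φ)
    (add_zero 1) (Subsingleton.elim _ _)
  obtain ⟨ψ, rfl⟩ := Ext.addEquiv₀.symm.surjective x
  refine ⟨ψ, Ext.addEquiv₀.symm.injective ?_⟩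
  simpa using hx

theorem exists_comp_eq_of_subsingleton_ext' {X : 𝒜} (h : Subsingleton (Ext X T.X₁ 1))
    (φ : X ⟶ T.X₃) : ∃ ψ : X ⟶ T.X₂, ψ ≫ T.g = φ := by
  obtain ⟨x, hx⟩ := Ext.covariant_sequence_exact₃ X hT (Ext.mk₀ φ)
    (zero_add 1) (Subsingleton.elim _ _)
  obtain ⟨ψ, rfl⟩ := Ext.addEquiv₀.symm.surjective x
  refine ⟨ψ, Ext.addEquiv₀.symm.injective ?_⟩
  simpa using hx

theorem subsingleton_ext_X₂_left {Y : 𝒜} {n : ℕ} (h₁ : Subsingleton (Ext T.X₁ Y n))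
    (h₃ : Subsingleton (Ext T.X₃ Y n)) : Subsingleton (Ext T.X₂ Y n) :=
  subsingleton_of_forall_eq 0 fun x => by
    obtain ⟨y, rfl⟩ := Ext.contravariant_sequence_exact₂ hT _ x (Subsingleton.elim _ _)
    rw [Subsingleton.elim y 0, Ext.comp_zero]

theorem subsingleton_ext_X₁_left {Y : 𝒜} {n : ℕ} (h₂ : Subsingleton (Ext T.X₂ Y n))
    (h₃ : Subsingleton (Ext T.X₃ Y (1 + n))) : Subsingleton (Ext T.X₁ Y n) :=
  subsingleton_of_forall_eq 0 fun x => by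
    obtain ⟨y, rfl⟩ := Ext.contravariant_sequence_exact₁ hT _ x rfl (Subsingleton.elim _ _)
    rw [Subsingleton.elim y 0, Ext.comp_zero]

theorem subsingleton_ext_X₂_right {X : 𝒜} {n : ℕ} (h₁ : Subsingleton (Ext X T.X₁ n))
    (h₃ : Subsingleton (Ext X T.X₃ n)) : Subsingleton (Ext X T.X₂ n) :=
  subsingleton_of_forall_eq 0 fun x => by
    obtain ⟨y, rfl⟩ := Ext.covariant_sequence_exact₂ _ hT x (Subsingleton.elim _ _)
    rw [Subsingleton.elim y 0, Ext.zero_comp]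

theorem subsingleton_ext_X₁_right {X : 𝒜} {n : ℕ} (h₂ : Subsingleton (Ext X T.X₂ (n + 1)))
    (h₃ : ∀ y : Ext X T.X₃ n, ∃ z : Ext X T.X₂ n, z.comp (Ext.mk₀ T.g) (add_zero n) = y) :
    Subsingleton (Ext X T.X₁ (n + 1)) :=
  subsingleton_of_forall_eq 0 fun x => by
    obtain ⟨y, rfl⟩ := Ext.covariant_sequence_exact₁ _ hT x (Subsingleton.elim _ _) rfl
    obtain ⟨z, rfl⟩ := h₃ y
    rw [Ext.comp_assoc_of_second_deg_zero, hT.comp_extClass, Ext.comp_zero]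

end Ext

section Adjunction

open Limits Abelian

universe t v w v' w'

theorem exact_iff_forall_injective {ℬ : Type w} [Category.{v} ℬ] [Abelian ℬ] [EnoughInjectives ℬ]
    (S : ShortComplex ℬ) :
    S.Exact ↔ ∀ (I : ℬ) [Injective I] (φ : S.X₂ ⟶ I), S.f ≫ φ = 0 →
      ∃ ψ : S.X₃ ⟶ I, S.g ≫ ψ = φ := by
  constructor
  · intro hS I _ φ hφ
    exact ⟨hS.descToInjective φ hφ, hS.comp_descToInjective φ hφ⟩
  · intro h
    obtain ⟨ψ, hψ⟩ := h _ (cokernel.π S.f ≫ Injective.ι (cokernel S.f)) (by simp)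
    have hψ' : cokernel.desc S.f S.g S.zero ≫ ψ = Injective.ι (cokernel S.f) := by
      rw [← cancel_epi (cokernel.π S.f), cokernel.π_desc_assoc, hψ]
    exact S.exact_iff_mono_cokernel_desc.2 (mono_of_mono_fac hψ')

variable {𝒜 : Type w} [Category.{v} 𝒜] [Abelian 𝒜] [HasExt.{t} 𝒜] [HasProjectiveResolutions 𝒜]
  {ℬ : Type w'} [Category.{v'} ℬ] [Abelian ℬ] [EnoughInjectives ℬ]
  {F : 𝒜 ⥤ ℬ} {G : ℬ ⥤ 𝒜} [F.Additive] (adj : F ⊣ G)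

include adj

theorem isZero_leftDerived_succ_iff (N : 𝒜) (n : ℕ) :
    IsZero ((F.leftDerived (n + 1)).obj N) ↔
      ∀ (I : ℬ) [Injective I], Subsingleton (Ext N (G.obj I) (n + 1)) := by
  let P := projectiveResolution N
  simp_rw [(P.isoLeftDerivedObj F (n + 1)).isZero_iff, subsingleton_ext_succ_iff P]
  change IsZero (HomologicalComplex.homology _ (n + 1)) ↔ _
  rw [← HomologicalComplex.exactAt_iff_isZero_homology,
    HomologicalComplex.exactAt_iff' _ (n + 2) (n + 1) n (by simp only [ChainComplex.prev]; rfl)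
      (by simp), exact_iff_forall_injective]
  refine forall₂_congr fun I _ => (adj.homEquiv _ I).forall_congr fun {φ} => imp_congr ?_
    ((adj.homEquiv _ I).exists_congr fun {ψ} => ?_)
  · rw [← adj.homEquiv_naturality_left]
    exact ((adj.homAddEquiv _ I).map_eq_zero_iff).symm
  · rw [← adj.homEquiv_naturality_left, (adj.homEquiv _ I).apply_eq_iff_eq]
    rfl

theorem map_shortExact {T : ShortComplex 𝒜} (hT : T.ShortExact)
    (h : IsZero ((F.leftDerived 1).obj T.X₃)) : (T.map F).ShortExact := by
  have := adj.leftAdjoint_preservesColimits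
  have := hT.epi_g
  have : Mono (F.map T.f) := by
    obtain ⟨ψ, hψ⟩ := exists_comp_eq_of_subsingleton_ext hT
      ((isZero_leftDerived_succ_iff adj T.X₃ 0).1 h (Injective.under (F.obj T.X₁)))
      (adj.homEquiv _ _ (Injective.ι _))
    have hψ' : F.map T.f ≫ (adj.homEquiv _ _).symm ψ = Injective.ι _ := by
      rw [← adj.homEquiv_naturality_left_symm, hψ, Equiv.symm_apply_apply]
    exact mono_of_mono_fac hψ'
  exact { exact := hT.exact.map_of_epi_of_preservesCokernel F ‹_› inferInstance
          mono_f := this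
          epi_g := inferInstanceAs (Epi (F.map T.g)) }

theorem isZero_leftDerived_X₂ {T : ShortComplex 𝒜} (hT : T.ShortExact) {n : ℕ}
    (h₁ : IsZero ((F.leftDerived (n + 1)).obj T.X₁))
    (h₃ : IsZero ((F.leftDerived (n + 1)).obj T.X₃)) :
    IsZero ((F.leftDerived (n + 1)).obj T.X₂) := by
  rw [isZero_leftDerived_succ_iff adj] at h₁ h₃ ⊢
  exact fun I _ => subsingleton_ext_X₂_left hT (h₁ I) (h₃ I)

theorem isZero_leftDerived_X₁ {T : ShortComplex 𝒜} (hT : T.ShortExact) {n : ℕ}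
    (h₂ : IsZero ((F.leftDerived (n + 1)).obj T.X₂))
    (h₃ : IsZero ((F.leftDerived (n + 2)).obj T.X₃)) :
    IsZero ((F.leftDerived (n + 1)).obj T.X₁) := by
  rw [isZero_leftDerived_succ_iff adj] at h₂ h₃ ⊢
  refine fun I _ => subsingleton_ext_X₁_left hT (h₂ I) ?_
  rw [add_comm]
  exact h₃ I

theorem isIso_unit_app_X₂ {T : ShortComplex 𝒜} (hT : T.ShortExact)
    (h : IsZero ((F.leftDerived 1).obj T.X₃)) [Epi (G.map (F.map T.g))]
    (h₁ : IsIso (adj.unit.app T.X₁)) (h₃ : IsIso (adj.unit.app T.X₃)) :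
    IsIso (adj.unit.app T.X₂) := by
  have := adj.rightAdjoint_preservesLimits
  have := adj.right_adjoint_additive
  have hF := map_shortExact adj hT h
  have : Mono (F.map T.f) := hF.mono_f
  have hFG : (T.map (F ⋙ G)).ShortExact :=
    { exact := hF.exact.map_of_mono_of_preservesKernel G this inferInstance
      mono_f := inferInstanceAs (Mono (G.map (F.map T.f)))
      epi_g := ‹_› }
  exact ShortComplex.isIso₂_of_shortExact_of_isIso₁₃' (T.mapNatTrans adj.unit) hT hFG h₁ h₃

theorem isIso_unit_app_X₁ {T : ShortComplex 𝒜} (hT : T.ShortExact)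
    (h : IsZero ((F.leftDerived 1).obj T.X₃))
    (h₂ : IsIso (adj.unit.app T.X₂)) (h₃ : Mono (adj.unit.app T.X₃)) :
    IsIso (adj.unit.app T.X₁) := by
  have := adj.rightAdjoint_preservesLimits
  have := hT.mono_f
  have : Mono (F.map T.f) := (map_shortExact adj hT h).mono_f
  have hk : (G.map (F.map T.f) ≫ inv (adj.unit.app T.X₂)) ≫ T.g = 0 := by
    have := adj.right_adjoint_additive
    rw [← cancel_mono (adj.unit.app T.X₃), Category.assoc, Category.assoc,
      ← adj.unit_naturality T.g, IsIso.inv_hom_id_assoc, ← G.map_comp, ← F.map_comp,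
      T.zero, F.map_zero, G.map_zero, zero_comp]
  refine ⟨hT.exact.lift _ hk, ?_, ?_⟩
  · rw [← cancel_mono T.f]
    simp
  · rw [← cancel_mono (G.map (F.map T.f))]
    simp

end Adjunction

section HomModule

variable {R S C : Type u} [Ring R] [Ring S] [AddCommGroup C] [Module R C] [Module Sᵐᵒᵖ C]

/-- The map `C ⊗_S N → M` induced by a biadditive map that is `R`-linear in `C` and balanced
over `S`. -/
def btensorLift {N M : Type u} [AddCommGroup N] [Module S N] [AddCommGroup M]
    [Module R M] (φ : N →+ C →ₗ[R] M)
    (hφ : ∀ c (s : S) x, φ (s • x) c = φ x (MulOpposite.op s • c)) :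
    BTensor R S C N →ₗ[R] M :=
  Submodule.liftQ _ (TensorProduct.AlgebraTensorModule.lift
      { toFun c := ((LinearMap.evalAddMonoidHom c).comp φ).toIntLinearMap
        map_add' c d := LinearMap.ext fun x => map_add (φ x) c d
        map_smul' r c := LinearMap.ext fun x => map_smul (φ x) r c }) <| by
    rw [balancedRel, Submodule.span_le]
    rintro _ ⟨c, s, x, rfl⟩
    rw [SetLike.mem_coe, LinearMap.mem_ker, map_sub, sub_eq_zero]
    exact (hφ c s x).symm

variable (R S C) [SMulCommClass R Sᵐᵒᵖ C]

/-- The `S`-module structure `(s f)(c) = f(c s)` on `Hom_R(C, M)`, for an `(R,S)`-bimodule `C`. It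
is not an instance, since for `R = S` commutative it would compete with the pointwise one. -/
abbrev homModule (M : Type u) [AddCommGroup M] [Module R M] : Module S (C →ₗ[R] M) where
  smul s f := f ∘ₗ homothetyRight R S C s
  one_smul f := LinearMap.ext fun c => congrArg f (one_smul Sᵐᵒᵖ c)
  mul_smul s t f := LinearMap.ext fun c =>
    congrArg f (mul_smul (MulOpposite.op t) (MulOpposite.op s) c)
  smul_zero _ := rfl
  smul_add _ _ _ := rfl
  add_smul s t f := LinearMap.ext fun c =>
    (congrArg f (add_smul (MulOpposite.op s) (MulOpposite.op t) c)).trans (map_add f _ _)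
  zero_smul f := LinearMap.ext fun c => (congrArg f (zero_smul Sᵐᵒᵖ c)).trans (map_zero f)

/-- The functor `Hom_R(C, -) : Mod R ⥤ Mod S`. -/
def homFunctor : ModuleCat.{u} R ⥤ ModuleCat.{u} S where
  obj M := letI := homModule R S C M; ModuleCat.of S (C →ₗ[R] M)
  map {M M'} f :=
    letI := homModule R S C M
    letI := homModule R S C M'
    ModuleCat.ofHom
      { toFun φ := f.hom ∘ₗ φ
        map_add' φ ψ := LinearMap.comp_add φ ψ f.hom
        map_smul' _ _ := rfl }

/-- The adjunction between `C ⊗_S -` and `Hom_R(C, -)`, with unit `μ`. -/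
def tensorHomAdjunction : tensorFunctor R S C ⊣ homFunctor R S C :=
  .mkOfUnitCounit {
    unit := {
      app N :=
        letI := homModule R S C (BTensor R S C N)
        ModuleCat.ofHom (Y := C →ₗ[R] BTensor R S C N)
          { toFun := mu R S
            map_add' := mu_add R S
            map_smul' s x := LinearMap.ext fun c => mu_smul R S s x c } }
    counit := {
      app M :=
        letI := homModule R S C M
        ModuleCat.ofHom (btensorLift (.id (C →ₗ[R] M)) fun _ _ _ => rfl)
      naturality M M' f := by
        ext1
        exact btensor_hom_ext R S fun c φ => rfl }
    left_triangle := by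
      ext N : 3
      exact btensor_hom_ext R S fun c x => rfl }

theorem mu_bijective_iff_isIso_unit_app (N : ModuleCat.{u} S) :
    Function.Bijective (mu R S : N → (C →ₗ[R] BTensor R S C N)) ↔
      IsIso ((tensorHomAdjunction R S C).unit.app N) :=
  (ConcreteCategory.isIso_iff_bijective ((tensorHomAdjunction R S C).unit.app N)).symm

end HomModule

section Auslander

open Limits Abelian

variable {R S C : Type u} [Ring R] [Ring S] [AddCommGroup C] [Module R C] [Module Sᵐᵒᵖ C]
  [SMulCommClass R Sᵐᵒᵖ C] {T : ShortComplex (ModuleCat.{u} S)}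

theorem auslanderClass.X₂ (hT : T.ShortExact) (h₁ : auslanderClass R S C T.X₁)
    (h₃ : auslanderClass R S C T.X₃) : auslanderClass R S C T.X₂ := by
  have hF := map_shortExact (tensorHomAdjunction R S C) hT (h₃.tor_zero 1 le_rfl)
  refine ⟨fun i hi => ?_, fun i hi =>
    subsingleton_ext_X₂_right hF (h₁.ext_zero i hi) (h₃.ext_zero i hi), ?_⟩
  · obtain ⟨i, rfl⟩ := Nat.exists_eq_add_of_le' hi
    exact isZero_leftDerived_X₂ (tensorHomAdjunction R S C) hT (h₁.tor_zero _ hi)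
      (h₃.tor_zero _ hi)
  · have : Epi ((homFunctor R S C).map ((tensorFunctor R S C).map T.g)) :=
      (ModuleCat.epi_iff_surjective _).2 fun φ => by
        obtain ⟨ψ, hψ⟩ := exists_comp_eq_of_subsingleton_ext' hF (h₁.ext_zero 1 le_rfl)
          (ModuleCat.ofHom φ)
        exact ⟨ψ.hom, congrArg ModuleCat.Hom.hom hψ⟩
    exact (mu_bijective_iff_isIso_unit_app R S C _).2 <|
      isIso_unit_app_X₂ (tensorHomAdjunction R S C) hT (h₃.tor_zero 1 le_rfl)
        ((mu_bijective_iff_isIso_unit_app R S C _).1 h₁.mu_bijective)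
        ((mu_bijective_iff_isIso_unit_app R S C _).1 h₃.mu_bijective)

theorem auslanderClass.X₁ (hT : T.ShortExact) (h₂ : auslanderClass R S C T.X₂)
    (h₃ : auslanderClass R S C T.X₃) : auslanderClass R S C T.X₁ := by
  have hF := map_shortExact (tensorHomAdjunction R S C) hT (h₃.tor_zero 1 le_rfl)
  refine ⟨fun i hi => ?_, fun i hi => ?_, ?_⟩
  · obtain ⟨i, rfl⟩ := Nat.exists_eq_add_of_le' hi
    exact isZero_leftDerived_X₁ (tensorHomAdjunction R S C) hT (h₂.tor_zero _ hi)
      (h₃.tor_zero _ (by lia))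
  · obtain ⟨i, rfl⟩ := Nat.exists_eq_add_of_le' hi
    refine subsingleton_ext_X₁_right hF (h₂.ext_zero _ hi) fun y => ?_
    cases i with
    | zero =>
      -- Every map `C → C ⊗ T.X₃` is `μ x`, hence lifts to `C ⊗ T.X₂` along with `x`.
      obtain ⟨φ, rfl⟩ := Ext.addEquiv₀.symm.surjective y
      obtain ⟨x, hx⟩ := h₃.mu_bijective.surjective φ.hom
      obtain ⟨x, rfl⟩ := hT.moduleCat_surjective_g x
      exact ⟨Ext.mk₀ (ModuleCat.ofHom (mu R S x)),
        (Ext.mk₀_comp_mk₀ _ _).trans (congrArg Ext.mk₀ (ModuleCat.hom_ext hx))⟩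
    | succ i => exact ⟨0, (h₃.ext_zero (i + 1) (by lia)).elim _ _⟩
  · have := (mu_bijective_iff_isIso_unit_app R S C _).1 h₃.mu_bijective
    exact (mu_bijective_iff_isIso_unit_app R S C _).2 <|
      isIso_unit_app_X₁ (tensorHomAdjunction R S C) hT (h₃.tor_zero 1 le_rfl)
        ((mu_bijective_iff_isIso_unit_app R S C _).1 h₂.mu_bijective) (IsIso.mono_of_iso _)

end Auslander

section Free

open Limits Abelian

theorem subsingleton_ext_finsupp {R : Type u} [Ring R] {X : ModuleCat.{u} R}
    {P : ProjectiveResolution X} {n : ℕ} [Module.Finite R (P.complex.X (n + 1))] (J : Type u)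
    {Z : Type u} [AddCommGroup Z] [Module R Z]
    (hZ : Subsingleton (Ext.{u} X (ModuleCat.of R Z) (n + 1))) :
    Subsingleton (Ext.{u} X (ModuleCat.of R (J →₀ Z)) (n + 1)) := by
  rw [subsingleton_ext_succ_iff P] at hZ ⊢
  intro f hf
  obtain ⟨φ, hφ⟩ := (LinearMap.finsuppLinearMap_bijective_of_moduleFinite R
    (P.complex.X (n + 1)) Z J ℤ).surjective f.hom
  let D (g : P.complex.X n →ₗ[R] Z) : P.complex.X (n + 1) →ₗ[R] Z :=
    g ∘ₗ (P.complex.d (n + 1) n).hom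
  have hD : φ ∈ Set.range (Finsupp.mapRange D (LinearMap.zero_comp _) : (J →₀ _) → J →₀ _) := by
    rw [Finsupp.range_mapRange]
    intro j
    obtain ⟨g, hg⟩ := hZ (ModuleCat.ofHom (φ j)) <| by
      ext x
      have hfx : f.hom (P.complex.d (n + 2) (n + 1) x) = 0 :=
        LinearMap.congr_fun (congrArg ModuleCat.Hom.hom hf) x
      rw [← hφ] at hfx
      exact DFunLike.congr_fun hfx j
    exact ⟨g.hom, congrArg ModuleCat.Hom.hom hg⟩
  obtain ⟨γ, rfl⟩ := hD
  refine ⟨ModuleCat.ofHom (LinearMap.finsuppLinearMap ℤ γ), ModuleCat.hom_ext ?_⟩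
  rw [← hφ]
  ext x j
  rfl

variable {R S C : Type u} [Ring R] [Ring S] [AddCommGroup C] [Module R C] [Module Sᵐᵒᵖ C]
  [SMulCommClass R Sᵐᵒᵖ C] (J : Type u)

variable (R S C)

/-- The homothety map `S → Hom_R(C, C)`, as an additive map. -/
def homothetyRightHom : S →+ C →ₗ[R] C where
  toFun := homothetyRight R S C
  map_zero' := LinearMap.ext fun c => zero_smul Sᵐᵒᵖ c
  map_add' s t := LinearMap.ext fun c => add_smul (MulOpposite.op s) (MulOpposite.op t) c

/-- The map `S^(J) → Hom_R(C, C^(J))`, `x ↦ (c ↦ (c x_j)_j)`, which is `μ` up to the isomorphism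
`C ⊗_S S^(J) ≃ C^(J)`. -/
def finsuppHomothety : (J →₀ S) →+ C →ₗ[R] J →₀ C :=
  (LinearMap.finsuppLinearMap ℤ).toAddMonoidHom.comp
    (Finsupp.mapRange.addMonoidHom (homothetyRightHom R S C))

theorem finsuppHomothety_single (j : J) (s : S) (c : C) :
    finsuppHomothety R S C J (Finsupp.single j s) c = Finsupp.single j (MulOpposite.op s • c) := by
  classical
  ext i
  change MulOpposite.op (Finsupp.single j s i) • c = Finsupp.single j (MulOpposite.op s • c) i
  rw [Finsupp.single_apply, Finsupp.single_apply]
  split_ifs <;> simp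

/-- The isomorphism `C ⊗_S S^(J) ≃ C^(J)`, `c ⊗ x ↦ (c x_j)_j`. -/
def btensorFinsuppEquiv : BTensor R S C (J →₀ S) ≃ₗ[R] J →₀ C :=
  .ofLinearMap
    (btensorLift (finsuppHomothety R S C J) fun c s x =>
      Finsupp.ext fun j => mul_smul (MulOpposite.op (x j)) (MulOpposite.op s) c)
    (Finsupp.lsum ℕ fun j => mu R S (Finsupp.single j 1))
    (by
      refine Finsupp.lhom_ext fun j c => ?_
      rw [LinearMap.comp_apply, Finsupp.lsum_single]
      exact (finsuppHomothety_single R S C J j 1 c).trans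
        (congrArg (Finsupp.single j) (one_smul Sᵐᵒᵖ c)))
    (by
      refine btensor_hom_ext R S fun c x => ?_
      induction x using Finsupp.induction_linear with
      | zero => simp only [btmul, TensorProduct.tmul_zero, Submodule.Quotient.mk_zero, map_zero]
      | add x y hx hy => simp only [btmul_add, map_add, hx, hy]
      | single j s =>
        calc Finsupp.lsum ℕ (fun j => mu R S (Finsupp.single j 1))
              (finsuppHomothety R S C J (Finsupp.single j s) c)
            = mu R S (Finsupp.single j 1) (MulOpposite.op s • c) := by
              rw [finsuppHomothety_single, Finsupp.lsum_single]
          _ = mu R S (Finsupp.single j s) c := by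
              rw [← mu_smul, Finsupp.smul_single_one])

variable {R S C}

theorem finsuppHomothety_bijective [Module.Finite R C]
    (hS : Function.Bijective (homothetyRight R S C)) :
    Function.Bijective (finsuppHomothety R S C J) :=
  (LinearMap.finsuppLinearMap_bijective_of_moduleFinite R C C J ℤ).comp
    (Finsupp.mapRange_bijective _ (map_zero (homothetyRightHom R S C)) hS)

theorem mu_bijective_finsupp [Module.Finite R C]
    (hS : Function.Bijective (homothetyRight R S C)) :
    Function.Bijective (mu R S : (J →₀ S) → C →ₗ[R] BTensor R S C (J →₀ S)) :=
  ((LinearEquiv.refl R C).arrowCongrAddEquiv (btensorFinsuppEquiv R S C J)).bijective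
    |>.of_comp_iff' _ |>.1 (finsuppHomothety_bijective J hS)

theorem auslanderClass_finsupp (hfin : HasDegreewiseFiniteResolution R C)
    (hS : Function.Bijective (homothetyRight R S C))
    (hExt : ∀ i : ℕ, 1 ≤ i → Subsingleton (Ext.{u} (ModuleCat.of R C) (ModuleCat.of R C) i)) :
    auslanderClass R S C (ModuleCat.of S (J →₀ S)) := by
  obtain ⟨P, hP⟩ := hfin
  have : Module.Finite R C := .of_surjective (P.π.f 0).hom
    ((ModuleCat.epi_iff_surjective _).1 inferInstance)
  refine ⟨fun i hi => ?_, fun i hi => ?_, mu_bijective_finsupp J hS⟩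
  · obtain ⟨i, rfl⟩ := Nat.exists_eq_add_of_le' hi
    exact (tensorFunctor R S C).isZero_leftDerived_obj_projective_succ i _
  · obtain ⟨i, rfl⟩ := Nat.exists_eq_add_of_le' hi
    have : Subsingleton (extFunctorObj _ (i + 1) |>.obj (ModuleCat.of R (J →₀ C))) :=
      subsingleton_ext_finsupp (P := P) J (hExt (i + 1) hi)
    exact ((extFunctorObj _ (i + 1)).mapIso
      (btensorFinsuppEquiv R S C J).toModuleIso).addCommGroupIsoToAddEquiv.subsingleton

theorem isResolving_auslanderClass (hfin : HasDegreewiseFiniteResolution R C)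
    (hS : Function.Bijective (homothetyRight R S C))
    (hExt : ∀ i : ℕ, 1 ≤ i → Subsingleton (Ext.{u} (ModuleCat.of R C) (ModuleCat.of R C) i)) :
    IsResolving (auslanderClass R S C) where
  prop_X₂ := auslanderClass.X₂
  prop_X₁ := auslanderClass.X₁
  exists_epi N := ⟨ModuleCat.of S (N →₀ S), ModuleCat.ofHom (Finsupp.linearCombination S id),
    inferInstance, auslanderClass_finsupp N hfin hS hExt,
    (ModuleCat.epi_iff_surjective _).2 (Finsupp.linearCombination_id_surjective S N)⟩

end Free

end AuslanderPd

end

theorem proposition4p2_general (R S C : Type u) [Ring R] [Ring S] [AddCommGroup C] [Module R C]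
    [Module Sᵐᵒᵖ C] [SMulCommClass R Sᵐᵒᵖ C] (hfin : AuslanderPd.HasDegreewiseFiniteResolution R C)
    (hS : Function.Bijective (AuslanderPd.homothetyRight R S C))
    (hExt : ∀ i : ℕ, 1 ≤ i →
      Subsingleton (Abelian.Ext.{u} (ModuleCat.of R C) (ModuleCat.of R C) i)) :
    (∀ N : ShortComplex (ModuleCat.{u} S), N.ShortExact → AuslanderPd.finiteAuslanderPd R S C N.X₁ →
      AuslanderPd.finiteAuslanderPd R S C N.X₃ → AuslanderPd.finiteAuslanderPd R S C N.X₂) ∧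
    (∀ N : ShortComplex (ModuleCat.{u} S), N.ShortExact → AuslanderPd.finiteAuslanderPd R S C N.X₂ →
      AuslanderPd.finiteAuslanderPd R S C N.X₃ → AuslanderPd.finiteAuslanderPd R S C N.X₁) ∧
    (∀ N : ShortComplex (ModuleCat.{u} S), N.ShortExact → AuslanderPd.finiteAuslanderPd R S C N.X₁ →
      AuslanderPd.finiteAuslanderPd R S C N.X₂ → AuslanderPd.finiteAuslanderPd R S C N.X₃) := by
  have hP := AuslanderPd.isResolving_auslanderClass hfin hS hExt
  simp only [AuslanderPd.finiteAuslanderPd,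
    AuslanderPd.relProjDim_lt_top_iff fun _ hZ => hP.prop_of_isZero hZ]
  exact ⟨fun _ => hP.hasFiniteResolution_X₂, fun _ => hP.hasFiniteResolution_X₁,
    fun _ => hP.hasFiniteResolution_X₃⟩

/-- For a short exact sequence `0 → N₁ → N₂ → N₃ → 0`, if two of the modules have finite Auslander
projective dimension then so has the third: the class is closed under extensions, kernels of
epimorphisms and cokernels of monomorphisms. -/
theorem proposition4p2 (R S C : Type u) [Ring R] [Ring S] [AddCommGroup C] [Module R C]
    [Module Sᵐᵒᵖ C] [SMulCommClass R Sᵐᵒᵖ C] (hC : AuslanderPd.IsSemidualizing R S C) :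
    (∀ N : CategoryTheory.ShortComplex (ModuleCat.{u} S), N.ShortExact →
      AuslanderPd.finiteAuslanderPd R S C N.X₁ → AuslanderPd.finiteAuslanderPd R S C N.X₃ →
      AuslanderPd.finiteAuslanderPd R S C N.X₂) ∧
    (∀ N : CategoryTheory.ShortComplex (ModuleCat.{u} S), N.ShortExact →
      AuslanderPd.finiteAuslanderPd R S C N.X₂ → AuslanderPd.finiteAuslanderPd R S C N.X₃ →
      AuslanderPd.finiteAuslanderPd R S C N.X₁) ∧
    (∀ N : CategoryTheory.ShortComplex (ModuleCat.{u} S), N.ShortExact →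
      AuslanderPd.finiteAuslanderPd R S C N.X₁ → AuslanderPd.finiteAuslanderPd R S C N.X₂ →
      AuslanderPd.finiteAuslanderPd R S C N.X₃) :=
  proposition4p2_general R S C hC.finite_left hC.homothety_right hC.ext_left
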